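/- Let $M$ and $B$ be smooth finite-dimensional Riemannian manifolds without boundary, regarded as metric spaces with their Riemannian distances $d_M$, $d_B$, and let $\pi: M\to B$ be a Riemannian submersion, i.e. a smooth surjective map whose derivative is surjective at every point and preserves the length of horizontal vectors (those orthogonal to the kernel of $d\pi$). Suppose that $B$ is connected and complete, and that $M$ is complete or, more generally, that every $C^1$ curve $[0,1]\to B$ has a horizontal $C^1$ lift to $M$ starting at any prescribed point of the fiber over its initial point. Suppose that for some constant $m>0$ $$\operatorname{diam}\big(\pi^{-1}(b)\big)\le m<\infty\qquad\text{for all } b\in B,$$ where the diameter is taken with respect to $d_M$. Then $\pi$ is a rough isometry, that is, there are constants $A\ge 1$, $C\ge 0$ with $$\tfrac1A\, d_M(p_1,p_2)-C\le d_B(\pi(p_1),\pi(p_2))\le A\, d_M(p_1,p_2)+C\qquad\text{for all } p_1,p_2\in M,$$ and there is an $\varepsilon>0$ such that every point of $B$ is at distance less than $\varepsilon$ from the image of $\pi$. In particular, if for some $b_0\in B$ the fiber $\pi^{-1}(b_0)$ is compact, then $M$ is roughly isometric to the product $\pi^{-1}(b_0)\times B$, that is, there is a rough isometry from $M$ to $\pi^{-1}(b_0)\times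 B$ (a map satisfying the same two conditions), where $\pi^{-1}(b_0)$ carries the metric induced from $(M,d_M)$ and the product carries the metric $\sqrt{d_M^2+d_B^2}$. -/

import Mathlib

open Bundle
open scoped Manifold ContDiff ENNReal NNReal

/-- A map `φ` between (extended) metric spaces, not necessarily continuous, is a *rough isometry*
if it distorts distances at most by a multiplicative constant `A ≥ 1` and an additive constant
`C ≥ 0`, and some `ε`-neighbourhood of its image is the whole target. Distances take values in
`[0, ∞]`, where `a - C` means `max (a - C) 0`; since distances are nonnegative, the lower bound
says the same as with real subtraction. -/
structure IsRoughIsometry {X Y : Type*} [PseudoEMetricSpace X] [PseudoEMetricSpace Y]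
    (φ : X → Y) : Prop where
  exists_distortion : ∃ A C : ℝ≥0, 1 ≤ A ∧ ∀ p₁ p₂ : X,
    (1 / A) * edist p₁ p₂ - C ≤ edist (φ p₁) (φ p₂) ∧
      edist (φ p₁) (φ p₂) ≤ A * edist p₁ p₂ + C
  full : ∃ ε : ℝ≥0, 0 < ε ∧ ∀ q : Y, Metric.infEDist q (Set.range φ) < ε

/-- `X` is roughly isometric to `Y` if there is a rough isometry from `X` to `Y`. -/
def RoughlyIsometric (X Y : Type*) [PseudoEMetricSpace X] [PseudoEMetricSpace Y] : Prop :=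
  ∃ φ : X → Y, IsRoughIsometry φ

section Submersion

variable {E : Type*} [NormedAddCommGroup E] [NormedSpace ℝ E]
  {H : Type*} [TopologicalSpace H] (I : ModelWithCorners ℝ E H)
  {M : Type*} [TopologicalSpace M] [ChartedSpace H M]
  [RiemannianBundle (fun x : M ↦ TangentSpace I x)]
  {E' : Type*} [NormedAddCommGroup E'] [NormedSpace ℝ E']
  {H' : Type*} [TopologicalSpace H'] (J : ModelWithCorners ℝ E' H')
  {B : Type*} [TopologicalSpace B] [ChartedSpace H' B]

/-- A tangent vector `v` to `M` at `x` is *horizontal* for `p` if it is orthogonal to every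
vertical vector, i.e. to the kernel of the derivative of `p` at `x`. -/
def IsHorizontal (p : M → B) (x : M) (v : TangentSpace I x) : Prop :=
  ∀ u : TangentSpace I x, mfderiv I J p x u = 0 → inner ℝ u v = 0

/-- A *Riemannian submersion*: a smooth map onto `B` whose derivative is everywhere surjective
and preserves the length of horizontal vectors. -/
structure IsRiemannianSubmersion [RiemannianBundle (fun b : B ↦ TangentSpace J b)]
    (p : M → B) : Prop where
  contMDiff : ContMDiff I J ∞ p
  surjective : Function.Surjective p
  maximal_rank : ∀ x : M, Function.Surjective (mfderiv I J p x)
  norm_eq : ∀ (x : M) (v : TangentSpace I x), IsHorizontal I J p x v → ‖mfderiv I J p x v‖ = ‖v‖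

/-- Every `C¹` curve `γ : [0, 1] → B` has a horizontal `C¹` lift to `M` starting at any prescribed
point of the fibre over `γ 0`. -/
def HasHorizontalLifts (p : M → B) : Prop :=
  ∀ γ : ℝ → B, ContMDiffOn 𝓘(ℝ, ℝ) J 1 γ (Set.Icc 0 1) → ∀ x : M, p x = γ 0 →
    ∃ Γ : ℝ → M, ContMDiffOn 𝓘(ℝ, ℝ) I 1 Γ (Set.Icc 0 1) ∧ Γ 0 = x ∧
      (∀ t ∈ Set.Icc (0 : ℝ) 1, p (Γ t) = γ t) ∧
      ∀ t ∈ Set.Icc (0 : ℝ) 1,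
        IsHorizontal I J p (Γ t) (mfderivWithin 𝓘(ℝ, ℝ) I Γ (Set.Icc 0 1) t (1 : ℝ))

end Submersion

/-!
The submersion `p` does not increase distances: the length of a tangent vector is at least the
length of its horizontal part, which is the length of its image. Conversely, every point `q` of the
base is the image of some `z` with `edist x z ≤ 4 * edist (p x) q`. Since two points of a fibre are
at distance at most `m`, this gives `edist x y ≤ 4 * edist (p x) (p y) + m`, and `p` is a rough
isometry. For the product one takes the map `x ↦ (x₀, p x)`, whose image is cobounded because the
fibre through `x₀` is bounded.

If horizontal lifts exist, the point `z` is the endpoint of the lift of a nearly shortest path. If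
instead `M` is complete, no differential equation is solved. By the inverse function theorem, `p`
has near `p x` a local section through `x` whose derivative at `p x` takes horizontal values, hence
has norm at most `1` there and less than `2` nearby; so points `q` close to `p x` have a preimage at
distance at most `2 * edist (p x) q` from `x` (`exists_forall_edist_lt_exists_eq`). Hence a point
`y` not over `q` can be moved so that `f y = edist (p y) q` decreases by at least a quarter of the
distance moved, and a descent argument of Ekeland type on the complete space `M`
(`exists_eq_zero_of_forall_exists_descent`) yields a zero of `f` at distance at most `4 * f x`
from `x`.
-/

section

open Set Filter Topology

/-! ### Linear maps isometric on the orthogonal complement of the kernel -/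

section LinearAlgebra

variable {V W : Type*} [NormedAddCommGroup V] [InnerProductSpace ℝ V] [FiniteDimensional ℝ V]
  [NormedAddCommGroup W] [NormedSpace ℝ W]

lemma norm_apply_le_of_isometry_on_orthogonal_ker {D : V →ₗ[ℝ] W}
    (hD : ∀ v, (∀ u, D u = 0 → inner ℝ u v = 0) → ‖D v‖ = ‖v‖) (v : V) : ‖D v‖ ≤ ‖v‖ := by
  have hk : D ((LinearMap.ker D).starProjection v) = 0 :=
    (LinearMap.ker D).starProjection_apply_mem v
  have hv : D v = D (v - (LinearMap.ker D).starProjection v) := by rw [map_sub, hk, sub_zero]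
  rw [hv, hD _ fun u hu ↦ ?_]
  · rw [← Submodule.starProjection_orthogonal_val]
    exact Submodule.norm_starProjection_apply_le _ v
  · rw [real_inner_comm]
    exact (LinearMap.ker D).starProjection_inner_eq_zero v u hu

/-- The right inverse is obtained by projecting an arbitrary one to the orthogonal complement of the
kernel. -/
lemma exists_rightInverse_norm_le_of_isometry_on_orthogonal_ker {D : V →ₗ[ℝ] W}
    (hsurj : Function.Surjective D)
    (hD : ∀ v, (∀ u, D u = 0 → inner ℝ u v = 0) → ‖D v‖ = ‖v‖) :
    ∃ h : W →ₗ[ℝ] V, (∀ w, D (h w) = w) ∧ ∀ w, ‖h w‖ ≤ ‖w‖ := by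
  obtain ⟨r, hr⟩ := D.exists_rightInverse_of_surjective (LinearMap.range_eq_top.2 hsurj)
  have hr' (w : W) : D (r w) = w := congr($hr w)
  refine ⟨((LinearMap.ker D)ᗮ.starProjection : V →ₗ[ℝ] V) ∘ₗ r, ?_, ?_⟩
  all_goals
    intro w
    have hw : D ((LinearMap.ker D)ᗮ.starProjection (r w)) = w := by
      have hk : D ((LinearMap.ker D).starProjection (r w)) = 0 :=
        (LinearMap.ker D).starProjection_apply_mem _
      rw [Submodule.starProjection_orthogonal_val, map_sub, hk, sub_zero, hr']
  · exact hw
  · refine (hD ((LinearMap.ker D)ᗮ.starProjection (r w)) fun u hu ↦ ?_).symm.le.trans_eq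
      congr(‖$hw‖)
    exact (Submodule.mem_orthogonal _ _).1 ((LinearMap.ker D)ᗮ.starProjection_apply_mem _) u hu

end LinearAlgebra

/-! ### Descent on a complete space -/

section Metric

/-- A nonnegative continuous function on a complete space vanishes somewhere if from every point
where it is positive one can move so that it decreases in proportion to the distance moved. This is
Ekeland's variational principle, in the form of a bound on the distance to a zero. -/
lemma exists_eq_zero_of_forall_exists_descent {X : Type*} [PseudoEMetricSpace X] [CompleteSpace X]
    {f : X → ℝ} (hf : Continuous f) (hf0 : ∀ x, 0 ≤ f x) {K : ℝ} (hK : 0 ≤ K)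
    (h : ∀ y, 0 < f y → ∃ y', f y' < f y ∧ edist y y' ≤ ENNReal.ofReal (K * (f y - f y')))
    (x : X) : ∃ z, f z = 0 ∧ edist x z ≤ ENNReal.ofReal (K * f x) := by
  -- the points whose distance from `y` is at most `K` times the decrease of `f`
  let S (y : X) : Set X := {z | f z ≤ f y ∧ edist y z ≤ ENNReal.ofReal (K * (f y - f z))}
  have hS (y : X) : y ∈ S y := by simp [S]
  have hbdd (y : X) : BddBelow (f '' S y) := ⟨0, by rintro _ ⟨z, -, rfl⟩; exact hf0 z⟩
  have htrans {a b c : X} (hb : b ∈ S a) (hc : c ∈ S b) : c ∈ S a := by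
    refine ⟨hc.1.trans hb.1, (edist_triangle a b c).trans ?_⟩
    refine (add_le_add hb.2 hc.2).trans_eq ?_
    rw [← ENNReal.ofReal_add (mul_nonneg hK (sub_nonneg.2 hb.1))
      (mul_nonneg hK (sub_nonneg.2 hc.1))]
    ring_nf
  have hclosed (y : X) : IsClosed (S y) := by
    refine (isClosed_le hf continuous_const).inter
      (isClosed_le (continuous_const.edist continuous_id) ?_)
    exact ENNReal.continuous_ofReal.comp (by fun_prop)
  -- each new point nearly minimises `f` over the points reachable from the previous one
  have hnext (y : X) (n : ℕ) : ∃ z ∈ S y, f z < sInf (f '' S y) + (1 / 2 : ℝ) ^ n := by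
    obtain ⟨_, ⟨z, hz, rfl⟩, hlt⟩ := Real.lt_sInf_add_pos (s := f '' S y) ⟨_, y, hS y, rfl⟩
      (show (0 : ℝ) < (1 / 2) ^ n by positivity)
    exact ⟨z, hz, hlt⟩
  choose next hnext_mem hnext_lt using hnext
  let u : ℕ → X := fun n ↦ Nat.rec x (fun n y ↦ next y n) n
  have hu (n : ℕ) : u (n + 1) ∈ S (u n) := hnext_mem _ _
  have hmem {n k : ℕ} (hnk : n ≤ k) : u k ∈ S (u n) := by
    induction k, hnk using Nat.le_induction with
    | base => exact hS _
    | succ k _ ih => exact htrans ih (hu k)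
  have hanti : Antitone (fun n ↦ f (u n)) := antitone_nat_of_succ_le fun n ↦ (hu n).1
  have hconv : Tendsto (fun n ↦ f (u n)) atTop (𝓝 (⨅ n, f (u n))) :=
    tendsto_atTop_ciInf hanti ⟨0, by rintro _ ⟨n, rfl⟩; exact hf0 _⟩
  have hcauchy : CauchySeq u := by
    refine EMetric.cauchySeq_iff_le_tendsto_0.2
      ⟨fun N ↦ 2 * ENNReal.ofReal (K * (f (u N) - ⨅ n, f (u n))), ?_, ?_⟩
    · intro n k N hn hk
      have hN {j : ℕ} (hj : N ≤ j) :
          edist (u N) (u j) ≤ ENNReal.ofReal (K * (f (u N) - ⨅ n, f (u n))) := by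
        refine (hmem hj).2.trans (ENNReal.ofReal_le_ofReal ?_)
        gcongr
        exact ciInf_le ⟨0, by rintro _ ⟨n, rfl⟩; exact hf0 _⟩ j
      exact (edist_triangle_left _ _ (u N)).trans
        ((add_le_add (hN hn) (hN hk)).trans_eq (two_mul _).symm)
    · have h0 : Tendsto (fun N ↦ K * (f (u N) - ⨅ n, f (u n))) atTop (𝓝 0) := by
        simpa using (hconv.sub_const (⨅ n, f (u n))).const_mul K
      simpa using ENNReal.Tendsto.const_mul (a := 2) (ENNReal.tendsto_ofReal h0) (Or.inr (by simp))
  obtain ⟨z, hz⟩ := cauchySeq_tendsto_of_complete hcauchy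
  have hzS (n : ℕ) : z ∈ S (u n) :=
    (hclosed _).mem_of_tendsto hz (eventually_atTop.2 ⟨n, fun k hk ↦ hmem hk⟩)
  have hfz : f z = 0 := by
    by_contra hne
    obtain ⟨z', hlt, hd⟩ := h z ((hf0 z).lt_of_ne' hne)
    have hbound (n : ℕ) : f z ≤ f z' + (1 / 2 : ℝ) ^ n := by
      have h1 := csInf_le (hbdd (u n)) ⟨z', htrans (hzS n) ⟨hlt.le, hd⟩, rfl⟩
      have h2 := hnext_lt (u n) n
      have h3 : f z ≤ f (next (u n) n) := (hzS (n + 1)).1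
      linarith
    have hlim : Tendsto (fun n : ℕ ↦ f z' + (1 / 2 : ℝ) ^ n) atTop (𝓝 (f z' + 0)) :=
      (tendsto_pow_atTop_nhds_zero_of_lt_one (by norm_num) (by norm_num)).const_add _
    have := ge_of_tendsto' hlim hbound
    linarith
  have hxz := (hzS 0).2
  rw [hfz, sub_zero] at hxz
  exact ⟨z, hfz, hxz⟩

lemma edist_ne_top_of_connectedSpace {X : Type*} [PseudoEMetricSpace X] [ConnectedSpace X]
    (x y : X) : edist x y ≠ ⊤ := by
  have hclopen : IsClopen (Metric.eball x ⊤) := by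
    refine ⟨⟨isOpen_iff_mem_nhds.2 fun z hz ↦ ?_⟩, Metric.isOpen_eball⟩
    filter_upwards [Metric.eball_mem_nhds z one_pos] with w hw hwx
    refine hz ((edist_triangle z w x).trans_lt (ENNReal.add_lt_top.2 ⟨?_, hwx⟩))
    rw [edist_comm]
    exact (Metric.mem_eball.1 hw).trans ENNReal.one_lt_top
  have hy : y ∈ Metric.eball x ⊤ := by
    rw [hclopen.eq_univ ⟨x, by simp⟩]
    trivial
  rw [edist_comm]
  exact (Metric.mem_eball.1 hy).ne

end Metric

/-! ### Local sections and bounds on the derivative -/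

section

variable
  {E : Type*} [NormedAddCommGroup E] [NormedSpace ℝ E]
  {H : Type*} [TopologicalSpace H] {I : ModelWithCorners ℝ E H}
  {M : Type*} [TopologicalSpace M] [ChartedSpace H M]
  {E' : Type*} [NormedAddCommGroup E'] [NormedSpace ℝ E']
  {H' : Type*} [TopologicalSpace H'] {J : ModelWithCorners ℝ E' H'}
  {B : Type*} [TopologicalSpace B] [ChartedSpace H' B]

/-- A separate statement because the topology of a tangent space agrees with that of its Riemannian
norm only after unfolding, which instance search does not do. -/
lemma eventually_opNorm_lt {X V W : Type*} [TopologicalSpace X] [NormedAddCommGroup V]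
    [NormedSpace ℝ V] [NormedAddCommGroup W] [NormedSpace ℝ W] {A : X → V →L[ℝ] W} {x : X}
    (hA : ContinuousAt A x) {c : ℝ} (hc : ‖A x‖ < c) : ∀ᶠ y in 𝓝 x, ‖A y‖ < c :=
  hA.norm.eventually_lt_const hc

/-- A `C¹` map which is a submersion at `x` has a local section through `x`, and its derivative
at the base point may be prescribed among the right inverses of the derivative of the map. In
charts centred at `x` and `p x`, it is `u ↦ x + h (g u)`, where `g` is a local inverse of
`w ↦ p (x + h w)`, whose derivative at `0` is the identity. -/
lemma exists_local_section_of_rightInverse [I.Boundaryless] [J.Boundaryless] [CompleteSpace E']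
    {p : M → B} {x : M} (hp : ContMDiffAt I J 1 p x)
    (h : TangentSpace J (p x) →L[ℝ] TangentSpace I x)
    (hh : ∀ w, mfderiv I J p x (h w) = w) :
    ∃ s : B → M, s (p x) = x ∧ ContMDiffAt J I 1 s (p x) ∧ (∀ᶠ q in 𝓝 (p x), p (s q) = q) ∧
      HasMFDerivAt J I s (p x) h := by
  let φ := extChartAt I x
  let ψ := extChartAt J (p x)
  let P : E → E' := ψ ∘ p ∘ φ.symm
  let P' : E →L[ℝ] E' := mfderiv I J p x
  let h' : E' →L[ℝ] E := h
  have hP : ContDiffAt ℝ 1 P (φ x) := by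
    have := (contMDiffAt_iff.1 hp).2
    rwa [I.range_eq_univ, contDiffWithinAt_univ] at this
  have hP' : HasFDerivAt P P' (φ x) := by
    refine HasFDerivWithinAt.hasFDerivAt (s := range I)
      (hp.mdifferentiableAt one_ne_zero).hasMFDerivAt.2 ?_
    rw [I.range_eq_univ]
    exact univ_mem
  let G : E' → E' := fun w ↦ P (φ x + h' w)
  have hL0 : φ x + h' 0 = φ x := by simp
  have hG : ContDiffAt ℝ 1 G 0 := by
    refine ContDiffAt.comp (0 : E') (g := P) (by rwa [hL0]) (by fun_prop)
  have hG' : HasFDerivAt G ((ContinuousLinearEquiv.refl ℝ E' : E' ≃L[ℝ] E') : E' →L[ℝ] E') 0 := by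
    have h1 : HasFDerivAt (fun w ↦ φ x + h' w) h' 0 := h'.hasFDerivAt.const_add _
    have h2 : HasFDerivAt G (P' ∘L h') 0 := by
      refine HasFDerivAt.comp (0 : E') (g := P) (by rwa [hL0]) h1
    have h3 : P' ∘L h' = ContinuousLinearMap.id ℝ E' :=
      ContinuousLinearMap.ext hh
    rwa [h3] at h2
  have hGs := hG.hasStrictFDerivAt' hG' one_ne_zero
  let g := hGs.localInverse G (ContinuousLinearEquiv.refl ℝ E') 0
  have hG0 : G 0 = ψ (p x) := by simp [G, P, φ]
  have hg : ContDiffAt ℝ 1 g (ψ (p x)) := hG0 ▸ hG.to_localInverse hG' one_ne_zero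
  have hg' : HasFDerivAt g (ContinuousLinearMap.id ℝ E') (ψ (p x)) :=
    hG0 ▸ hGs.to_localInverse.hasFDerivAt
  have hg0 : g (ψ (p x)) = 0 := hG0 ▸ hGs.localInverse_apply_image
  have hGg : ∀ᶠ u in 𝓝 (ψ (p x)), G (g u) = u := hG0 ▸ hGs.eventually_right_inverse
  let σ : E' → E := fun u ↦ φ x + h' (g u)
  have hσ : ContDiffAt ℝ 1 σ (ψ (p x)) := by fun_prop
  have hσ' : HasFDerivAt σ h' (ψ (p x)) := by
    exact (h'.hasFDerivAt.comp (ψ (p x)) hg').const_add (φ x)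
  have hσ0 : σ (ψ (p x)) = φ x := by simp [σ, hg0]
  let s : B → M := fun q ↦ φ.symm (σ (ψ q))
  have hs0 : s (p x) = x := by simp [s, hσ0, φ]
  have hψ : ContinuousAt ψ (p x) := continuousAt_extChartAt (p x)
  have hφ : ContinuousAt φ.symm (σ (ψ (p x))) := by
    rw [hσ0]
    exact continuousAt_extChartAt_symm x
  have hs : ContinuousAt s (p x) := ContinuousAt.comp (f := σ ∘ ψ) hφ (hσ.continuousAt.comp hψ)
  -- read in the charts at `p x` and `x`, the section `s` is `σ`
  have hchart : (extChartAt I (s (p x)) ∘ s ∘ ψ.symm) =ᶠ[𝓝 (ψ (p x))] σ := by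
    rw [hs0]
    have h1 : ∀ᶠ u in 𝓝 (ψ (p x)), σ u ∈ φ.target := by
      refine hσ.continuousAt.eventually_mem ?_
      rw [hσ0]
      exact extChartAt_target_mem_nhds x
    filter_upwards [h1, extChartAt_target_mem_nhds (I := J) (p x)] with u hu hu'
    simp only [Function.comp_apply, s]
    rw [ψ.right_inv hu', φ.right_inv hu]
  refine ⟨s, hs0, ?_, ?_, hs, ?_⟩
  · refine contMDiffAt_iff.2 ⟨hs, ?_⟩
    exact (hσ.congr_of_eventuallyEq hchart).contDiffWithinAt
  · have hps : ContinuousAt (p ∘ s) (p x) :=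
      ContinuousAt.comp (by rw [hs0]; exact hp.continuousAt) hs
    have h1 : ∀ᶠ q in 𝓝 (p x), p (s q) ∈ ψ.source := by
      refine hps.eventually_mem ?_
      simp only [Function.comp_apply, hs0]
      exact extChartAt_source_mem_nhds (p x)
    filter_upwards [h1, extChartAt_source_mem_nhds (I := J) (p x), hψ.eventually hGg]
      with q hq hq' hGq
    exact ψ.injOn hq hq' hGq
  · exact (hσ'.congr_of_eventuallyEq hchart).hasFDerivWithinAt

variable [RiemannianBundle (fun x : M ↦ TangentSpace I x)]
  [RiemannianBundle (fun b : B ↦ TangentSpace J b)]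

/-- The norms live on varying tangent spaces. The derivative at `y` is compared with a map between
the tangent spaces at `x` and `f x`, by means of trivializations, which identify nearby tangent
spaces almost isometrically. -/
lemma eventually_norm_mfderiv_lt [IsManifold I 2 M] [IsManifold J 2 B]
   [IsContinuousRiemannianBundle E (fun x : M ↦ TangentSpace I x)]
   [IsContinuousRiemannianBundle E' (fun x : B ↦ TangentSpace J x)] {f : M → B} {x : M}
    (hf : ContMDiffAt I J 1 f x) {C : ℝ} (hC : ‖mfderiv I J f x‖ < C) :
    ∀ᶠ y in 𝓝 x, ‖mfderiv I J f y‖ < C := by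
  have : IsManifold I 1 M := .of_le (n := 2) one_le_two
  have : IsManifold J 1 B := .of_le (n := 2) one_le_two
  let e := trivializationAt E (fun x : M ↦ TangentSpace I x) x
  let e' := trivializationAt E' (fun b : B ↦ TangentSpace J b) (f x)
  have hx : x ∈ e.baseSet := FiberBundle.mem_baseSet_trivializationAt' x
  have hfx : f x ∈ e'.baseSet := FiberBundle.mem_baseSet_trivializationAt' (f x)
  -- the derivative at `y` read in the trivializations, then as a map from the fibre over `x`
  let D (y : M) : E →L[ℝ] E' := ContinuousLinearMap.inCoordinates E (fun x : M ↦ TangentSpace I x)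
    E' (fun b : B ↦ TangentSpace J b) x y (f x) (f y) (mfderiv I J f y)
  let A (y : M) : TangentSpace I x →L[ℝ] TangentSpace J (f x) :=
    (e'.symmL ℝ (f x)) ∘L (D y) ∘L (e.continuousLinearMapAt ℝ x)
  have hD : ContinuousAt D x := (hf.mfderiv_const (m := 0) le_rfl).continuousAt
  have hA : ContinuousAt A x := by
    exact continuousAt_const.clm_comp (hD.clm_comp continuousAt_const)
  have hfactor (y : M) (hy : y ∈ e.baseSet) (hfy : f y ∈ e'.baseSet) (v : TangentSpace I y) :
     e'.symmL ℝ (f y) (D y (e.continuousLinearMapAt ℝ y v)) = mfderiv I J f y v := by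
    simp only [D, ContinuousLinearMap.inCoordinates, ContinuousLinearMap.comp_apply]
    rw [e'.symmL_continuousLinearMapAt hfy, e.symmL_continuousLinearMapAt hy]
  have hAx : A x = mfderiv I J f x := by
    ext v
    exact hfactor x hx hfx v
  obtain ⟨c, hc, hcC⟩ := exists_between hC
  have hc0 : 0 ≤ c := (norm_nonneg (mfderiv I J f x)).trans hc.le
  obtain ⟨r, hr1, hrC⟩ : ∃ r : ℝ, 1 < r ∧ r * c * r < C := by
    have h1 : Tendsto (fun r : ℝ ↦ r * c * r) (𝓝[>] 1) (𝓝 (1 * c * 1)) :=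
      (Continuous.tendsto (by fun_prop) 1).mono_left nhdsWithin_le_nhds
    have h2 : ∀ᶠ r in 𝓝[>] (1 : ℝ), r * c * r < C := h1.eventually_lt_const (by simpa using hcC)
    exact ((eventually_mem_nhdsWithin (s := Ioi (1 : ℝ))).and h2).exists
  have hAc : ∀ᶠ y in 𝓝 x, ‖A y‖ < c :=
    eventually_opNorm_lt hA (by rwa [hAx])
  filter_upwards [hAc, e.open_baseSet.mem_nhds hx,
    hf.continuousAt.preimage_mem_nhds (e'.open_baseSet.mem_nhds hfx),
    eventually_norm_symmL_trivializationAt_self_comp_lt E (fun x : M ↦ TangentSpace I x) x hr1,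
    hf.continuousAt.eventually (eventually_norm_symmL_trivializationAt_comp_self_lt E'
      (fun b : B ↦ TangentSpace J b) (f x) hr1)] with y hAy hy hfy hT hT'
  refine (ContinuousLinearMap.opNorm_le_bound _ (by positivity) fun v ↦ ?_).trans_lt hrC
  let T := (e.symmL ℝ x) ∘L (e.continuousLinearMapAt ℝ y)
  let T' := (e'.symmL ℝ (f y)) ∘L (e'.continuousLinearMapAt ℝ (f x))
  have hv : mfderiv I J f y v = T' (A y (T v)) := by
    rw [← hfactor y hy hfy v]
    simp only [T, T', A, ContinuousLinearMap.comp_apply]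
    rw [e'.continuousLinearMapAt_symmL hfx, e.continuousLinearMapAt_symmL hx]
  rw [hv]
  calc ‖T' (A y (T v))‖
      ≤ r * (c * (r * ‖v‖)) := by
        refine (T'.le_of_opNorm_le hT'.le _).trans ?_
        gcongr
        refine ((A y).le_of_opNorm_le hAy.le _).trans ?_
        gcongr
        exact T.le_of_opNorm_le hT.le v
    _ = r * c * r * ‖v‖ := by ring

lemma pathELength_comp_le {f : M → B} {γ : ℝ → M} {C : ℝ≥0} {a b : ℝ}
    (hγ : MDifferentiableOn 𝓘(ℝ, ℝ) I γ (Icc a b))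
    (hf : ∀ t ∈ Icc a b, MDifferentiableAt I J f (γ t))
    (hC : ∀ t ∈ Icc a b, ‖mfderiv I J f (γ t)‖ ≤ C) :
    Manifold.pathELength J (f ∘ γ) a b ≤ C * Manifold.pathELength I γ a b := by
  rcases le_or_gt b a with hab | hab
  · rcases hab.eq_or_lt with rfl | hab
    · simp
    · simp [Manifold.pathELength, Icc_eq_empty_of_lt hab]
  simp only [Manifold.pathELength_eq_lintegral_mfderivWithin_Icc]
  rw [← MeasureTheory.lintegral_const_mul' _ _ ENNReal.coe_ne_top]
  refine MeasureTheory.setLIntegral_mono' measurableSet_Icc fun t ht ↦ ?_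
  have hcomp : mfderivWithin 𝓘(ℝ, ℝ) J (f ∘ γ) (Icc a b) t =
      (mfderiv I J f (γ t)) ∘L (mfderivWithin 𝓘(ℝ, ℝ) I γ (Icc a b) t) := by
    refine mfderiv_comp_mfderivWithin t (hf t ht) (hγ t ht) ?_
    rw [uniqueMDiffWithinAt_iff_uniqueDiffWithinAt]
    exact uniqueDiffOn_Icc hab t ht
  have h1 : mfderivWithin 𝓘(ℝ, ℝ) J (f ∘ γ) (Icc a b) t 1 =
      (mfderiv I J f (γ t)) (mfderivWithin 𝓘(ℝ, ℝ) I γ (Icc a b) t 1) := congr($hcomp 1)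
  rw [h1]
  refine (ContinuousLinearMap.le_opENorm _ _).trans ?_
  gcongr
  exact enorm_le_coe.2 (hC t ht)

end

/-! ### From bounds on the derivative to Lipschitz bounds -/

section

variable
  {E : Type*} [NormedAddCommGroup E] [NormedSpace ℝ E]
  {H : Type*} [TopologicalSpace H] {I : ModelWithCorners ℝ E H}
  {M : Type*} [PseudoEMetricSpace M] [ChartedSpace H M]
  {E' : Type*} [NormedAddCommGroup E'] [NormedSpace ℝ E']
  {H' : Type*} [TopologicalSpace H'] {J : ModelWithCorners ℝ E' H'}
  {B : Type*} [PseudoEMetricSpace B] [ChartedSpace H' B]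
  [RiemannianBundle (fun x : M ↦ TangentSpace I x)]
  [RiemannianBundle (fun b : B ↦ TangentSpace J b)]
  [IsRiemannianManifold I M] [IsRiemannianManifold J B]

lemma exists_path_pathELength_lt {x y : M} {c : ℝ≥0∞} (h : edist x y < c) :
   ∃ γ : ℝ → M, γ 0 = x ∧ γ 1 = y ∧ ContMDiffOn 𝓘(ℝ, ℝ) I 1 γ (Icc 0 1) ∧
    Manifold.pathELength I γ 0 1 < c := by
  rw [IsRiemannianManifold.out (I := I) x y] at h
  exact Manifold.exists_lt_of_riemannianEDist_lt h

lemma edist_le_pathELength {γ : ℝ → M} {a b : ℝ} (hγ : ContMDiffOn 𝓘(ℝ, ℝ) I 1 γ (Icc a b))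
    (hab : a ≤ b) :
    edist (γ a) (γ b) ≤ Manifold.pathELength I γ a b := by
  rw [IsRiemannianManifold.out (I := I)]
  exact Manifold.riemannianEDist_le_pathELength hγ rfl rfl hab

/-- A map is Lipschitz from the centre of any ball on which its derivative is bounded, because a
nearly shortest path from the centre does not leave the ball. -/
lemma edist_map_le_of_norm_mfderiv_le_on_eball [IsManifold I 1 M] [IsManifold J 1 B]
    {f : M → B} {x y : M}
    {r : ℝ≥0∞} {C : ℝ≥0} (hf : ∀ z ∈ Metric.eball x r, ContMDiffAt I J 1 f z)
    (hC : ∀ z ∈ Metric.eball x r, ‖mfderiv I J f z‖ ≤ C) (hy : edist x y < r) :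
    edist (f x) (f y) ≤ C * edist x y := by
  have hbound : ∀ c ∈ Ioo (edist x y) r, edist (f x) (f y) ≤ C * c := by
    rintro c ⟨hc, hcr⟩
    obtain ⟨γ, h0, h1, hγ, hlen⟩ := exists_path_pathELength_lt (I := I) hc
    have hball (t : ℝ) (ht : t ∈ Icc (0 : ℝ) 1) : γ t ∈ Metric.eball x r := by
      rw [Metric.mem_eball, edist_comm, ← h0]
      refine (edist_le_pathELength (I := I) (hγ.mono (Icc_subset_Icc_right ht.2)) ht.1).trans_lt ?_
      exact ((Manifold.pathELength_mono le_rfl ht.2).trans_lt hlen).trans hcr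
    have hfγ : ContMDiffOn 𝓘(ℝ, ℝ) J 1 (f ∘ γ) (Icc 0 1) := fun t ht ↦
      (hf _ (hball t ht)).comp_contMDiffWithinAt t (hγ t ht)
    calc edist (f x) (f y)
        = edist ((f ∘ γ) 0) ((f ∘ γ) 1) := by simp [h0, h1]
      _ ≤ Manifold.pathELength J (f ∘ γ) 0 1 := edist_le_pathELength hfγ zero_le_one
      _ ≤ C * Manifold.pathELength I γ 0 1 :=
          pathELength_comp_le (hγ.mdifferentiableOn one_ne_zero)
            (fun t ht ↦ (hf _ (hball t ht)).mdifferentiableAt one_ne_zero)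
            (fun t ht ↦ hC _ (hball t ht))
      _ ≤ C * c := by gcongr
  have hne : (𝓝[>] (edist x y)).NeBot := nhdsGT_neBot_of_exists_gt ⟨r, hy⟩
  have hlim : Tendsto (fun c : ℝ≥0∞ ↦ C * c) (𝓝[>] (edist x y)) (𝓝 (C * edist x y)) :=
    ((ENNReal.continuous_const_mul ENNReal.coe_ne_top).tendsto _).mono_left nhdsWithin_le_nhds
  refine ge_of_tendsto hlim ?_
  filter_upwards [Ioo_mem_nhdsGT hy] with c hc using hbound c hc

lemma eventually_edist_map_le [IsManifold I 2 M] [IsManifold J 2 B]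
    [IsContinuousRiemannianBundle E (fun x : M ↦ TangentSpace I x)]
    [IsContinuousRiemannianBundle E' (fun x : B ↦ TangentSpace J x)] {f : M → B} {x : M}
    (hf : ContMDiffAt I J 1 f x) {C : ℝ≥0} (hC : ‖mfderiv I J f x‖ < C) :
    ∀ᶠ y in 𝓝 x, edist (f x) (f y) ≤ C * edist x y := by
  have : IsManifold I 1 M := .of_le (n := 2) one_le_two
  have : IsManifold J 1 B := .of_le (n := 2) one_le_two
  obtain ⟨r, hr, hball⟩ := EMetric.mem_nhds_iff.1
    (((contMDiffAt_iff_contMDiffAt_nhds (by simp)).1 hf).and (eventually_norm_mfderiv_lt hf hC))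
  filter_upwards [Metric.eball_mem_nhds x hr] with y hy
  exact edist_map_le_of_norm_mfderiv_le_on_eball (fun z hz ↦ (hball hz).1)
    (fun z hz ↦ (hball hz).2.le) (by rwa [edist_comm])

end

/-! ### Riemannian submersions -/

lemma isContinuousRiemannianBundle_tangentSpace
    {E : Type*} [NormedAddCommGroup E] [NormedSpace ℝ E]
    {H : Type*} [TopologicalSpace H] (I : ModelWithCorners ℝ E H)
    {M : Type*} [TopologicalSpace M] [ChartedSpace H M] [IsManifold I ∞ M]
    [RiemannianBundle (fun x : M ↦ TangentSpace I x)]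
    [IsContMDiffRiemannianBundle I ∞ E (fun x : M ↦ TangentSpace I x)] :
    IsContinuousRiemannianBundle E (fun x : M ↦ TangentSpace I x) := by
  obtain ⟨g, hg, hgi⟩ := IsContMDiffRiemannianBundle.exists_contMDiff (IB := I) (n := ∞)
    (F := E) (E := fun x : M ↦ TangentSpace I x)
  exact ⟨g, hg.continuous, hgi⟩

/-- A Riemannian manifold is almost a geodesic space: the point `q` is taken on a path from `a` to
`b` of length less than `c`. -/
lemma exists_edist_eq_and_add_lt
    {E : Type*} [NormedAddCommGroup E] [NormedSpace ℝ E]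
    {H : Type*} [TopologicalSpace H] (J : ModelWithCorners ℝ E H)
    {B : Type*} [PseudoEMetricSpace B] [ChartedSpace H B]
    [RiemannianBundle (fun b : B ↦ TangentSpace J b)] [IsRiemannianManifold J B]
    {a b : B} {c ρ : ℝ≥0∞} (hc : edist a b < c)
    (hρ : ρ ≤ edist a b) : ∃ q, edist a q = ρ ∧ edist a q + edist q b < c := by
  obtain ⟨γ, h0, h1, hγ, hlen⟩ := exists_path_pathELength_lt (I := J) hc
  have hcont : ContinuousOn (fun t ↦ edist a (γ t)) (Icc 0 1) :=
    (continuous_const.edist continuous_id).comp_continuousOn hγ.continuousOn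
  obtain ⟨t, ht, hta⟩ := intermediate_value_Icc zero_le_one hcont
    (show ρ ∈ Icc (edist a (γ 0)) (edist a (γ 1)) by simpa [h0, h1] using hρ)
  refine ⟨γ t, hta, lt_of_le_of_lt ?_ hlen⟩
  rw [← Manifold.pathELength_add ht.1 ht.2]
  have h2 := edist_le_pathELength (I := J) (hγ.mono (Icc_subset_Icc_right ht.2)) ht.1
  have h3 := edist_le_pathELength (I := J) (hγ.mono (Icc_subset_Icc_left ht.1)) ht.2
  rw [h0] at h2
  rw [h1] at h3
  exact add_le_add h2 h3

section

variable
  {E : Type*} [NormedAddCommGroup E] [NormedSpace ℝ E] [FiniteDimensional ℝ E]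
  {H : Type*} [TopologicalSpace H] {I : ModelWithCorners ℝ E H}
  {E' : Type*} [NormedAddCommGroup E'] [NormedSpace ℝ E']
  {H' : Type*} [TopologicalSpace H'] {J : ModelWithCorners ℝ E' H'}

section Infinitesimal

variable {M : Type*} [TopologicalSpace M] [ChartedSpace H M]
  [RiemannianBundle (fun x : M ↦ TangentSpace I x)]
  {B : Type*} [TopologicalSpace B] [ChartedSpace H' B]
  [RiemannianBundle (fun b : B ↦ TangentSpace J b)]

lemma IsRiemannianSubmersion.norm_mfderiv_le_one {p : M → B}
    (hp : IsRiemannianSubmersion I J p) (x : M) : ‖mfderiv I J p x‖ ≤ 1 := by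
  have : FiniteDimensional ℝ (TangentSpace I x) := inferInstanceAs (FiniteDimensional ℝ E)
  refine ContinuousLinearMap.opNorm_le_bound _ zero_le_one fun v ↦ ?_
  rw [one_mul]
  exact norm_apply_le_of_isometry_on_orthogonal_ker
    (D := (mfderiv I J p x : TangentSpace I x →ₗ[ℝ] TangentSpace J (p x))) (hp.norm_eq x) v

lemma IsRiemannianSubmersion.exists_local_section [I.Boundaryless] [J.Boundaryless]
    [CompleteSpace E'] {p : M → B} (hp : IsRiemannianSubmersion I J p) (x : M) :
    ∃ s : B → M, s (p x) = x ∧ ContMDiffAt J I 1 s (p x) ∧ (∀ᶠ q in 𝓝 (p x), p (s q) = q) ∧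
      ‖mfderiv J I s (p x)‖ ≤ 1 := by
  have : FiniteDimensional ℝ (TangentSpace I x) := inferInstanceAs (FiniteDimensional ℝ E)
  obtain ⟨h, hh, hle⟩ := exists_rightInverse_norm_le_of_isometry_on_orthogonal_ker
    (D := (mfderiv I J p x : TangentSpace I x →ₗ[ℝ] TangentSpace J (p x)))
    (hp.maximal_rank x) (hp.norm_eq x)
  obtain ⟨s, hs0, hs, hps, hds⟩ := exists_local_section_of_rightInverse
    ((hp.contMDiff x).of_le (by simp)) (h.mkContinuous 1 fun w ↦ by simpa using hle w) hh
  refine ⟨s, hs0, hs, hps, ContinuousLinearMap.opNorm_le_bound _ zero_le_one fun w ↦ ?_⟩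
  -- `s (p x) = x` only holds propositionally, so the norms of the two fibres have to be identified
  have hnorm (y : M) (hy : y = x) (v : E) :
      ‖(show TangentSpace I y from v)‖ = ‖(show TangentSpace I x from v)‖ := by
    subst hy
    rfl
  rw [hds.mfderiv, one_mul]
  exact (hnorm _ hs0 _).trans_le (hle w)

end Infinitesimal

section Global

variable {M : Type*} [PseudoEMetricSpace M] [ChartedSpace H M]
  [RiemannianBundle (fun x : M ↦ TangentSpace I x)] [IsRiemannianManifold I M]
  {B : Type*} [PseudoEMetricSpace B] [ChartedSpace H' B]
  [RiemannianBundle (fun b : B ↦ TangentSpace J b)] [IsRiemannianManifold J B]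

lemma IsRiemannianSubmersion.edist_le [IsManifold I 1 M] [IsManifold J 1 B] {p : M → B}
    (hp : IsRiemannianSubmersion I J p) (x y : M) : edist (p x) (p y) ≤ edist x y := by
  rcases eq_or_ne (edist x y) ⊤ with hxy | hxy
  · simp [hxy]
  · simpa using edist_map_le_of_norm_mfderiv_le_on_eball (r := ⊤) (C := 1) (I := I) (J := J)
      (fun z _ ↦ (hp.contMDiff z).of_le (by simp)) (fun z _ ↦ hp.norm_mfderiv_le_one z)
      hxy.lt_top

/-- Points close to `p x` have preimages close to `x`, with a Lipschitz constant which does not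
depend on `x`; only the radius `r` does. -/
lemma IsRiemannianSubmersion.exists_forall_edist_lt_exists_eq [I.Boundaryless] [J.Boundaryless]
    [CompleteSpace E'] [IsManifold I 2 M] [IsManifold J 2 B]
    [IsContinuousRiemannianBundle E (fun x : M ↦ TangentSpace I x)]
    [IsContinuousRiemannianBundle E' (fun b : B ↦ TangentSpace J b)] {p : M → B}
    (hp : IsRiemannianSubmersion I J p) (x : M) :
    ∃ r : ℝ≥0∞, 0 < r ∧ ∀ q, edist (p x) q < r →
      ∃ y, p y = q ∧ edist x y ≤ 2 * edist (p x) q := by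
  obtain ⟨s, hs0, hs, hps, hds⟩ := hp.exists_local_section x
  have hlip := eventually_edist_map_le (C := 2) hs (hds.trans_lt (by norm_num))
  rw [hs0] at hlip
  obtain ⟨r, hr, hball⟩ := EMetric.mem_nhds_iff.1 (hps.and hlip)
  refine ⟨r, hr, fun q hq ↦ ?_⟩
  have hq' := hball (show q ∈ Metric.eball (p x) r by rwa [Metric.mem_eball, edist_comm])
  exact ⟨s q, hq'.1, by simpa using hq'.2⟩

/-- From a complete total space, a Riemannian submersion satisfies a global form of the open mapping
estimate: every `q` has a preimage, up to zero distance, whose distance from `x` is controlled by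
the distance from `p x` to `q`. -/
theorem IsRiemannianSubmersion.exists_eq_of_completeSpace [I.Boundaryless] [J.Boundaryless]
    [CompleteSpace E'] [IsManifold I 2 M] [IsManifold J 2 B]
    [IsContinuousRiemannianBundle E (fun x : M ↦ TangentSpace I x)]
    [IsContinuousRiemannianBundle E' (fun b : B ↦ TangentSpace J b)]
    [CompleteSpace M] [ConnectedSpace B] {p : M → B}
    (hp : IsRiemannianSubmersion I J p) (x : M) (q : B) :
    ∃ z, edist (p z) q = 0 ∧ edist x z ≤ 4 * edist (p x) q := by
  have hfin (a b : B) : edist a b ≠ ⊤ := edist_ne_top_of_connectedSpace a b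
  let f (y : M) : ℝ := (edist (p y) q).toReal
  have hf : Continuous f :=
    ENNReal.continuousOn_toReal.comp_continuous (hp.contMDiff.continuous.edist continuous_const)
      fun y ↦ hfin _ _
  have hdescent (y : M) (hy : 0 < f y) :
      ∃ y', f y' < f y ∧ edist y y' ≤ ENNReal.ofReal (4 * (f y - f y')) := by
    obtain ⟨r, hr, hlift⟩ := hp.exists_forall_edist_lt_exists_eq y
    -- a radius at which `hlift` applies and which does not exceed `f y`
    obtain ⟨ρ, hρ0, hρr, hρf⟩ : ∃ ρ : ℝ, 0 < ρ ∧ ENNReal.ofReal ρ < r ∧ ρ ≤ f y := by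
      obtain ⟨ρ, -, hρ0, hρ⟩ := ENNReal.lt_iff_exists_real_btwn.1
        (lt_min hr (ENNReal.ofReal_pos.2 hy))
      exact ⟨ρ, ENNReal.ofReal_pos.1 hρ0, hρ.trans_le (min_le_left _ _),
        (ENNReal.ofReal_le_ofReal_iff hy.le).1 (hρ.le.trans (min_le_right _ _))⟩
    obtain ⟨q', hq', hsum⟩ := exists_edist_eq_and_add_lt J (a := p y) (b := q)
      (c := ENNReal.ofReal (f y + ρ / 2)) (ρ := ENNReal.ofReal ρ)
      ((ENNReal.lt_ofReal_iff_toReal_lt (hfin _ _)).2 (by simp only [f]; linarith))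
      (ENNReal.ofReal_le_of_le_toReal hρf)
    obtain ⟨y', rfl, hy'⟩ := hlift q' (by rwa [hq'])
    have hdrop : f y' < f y - ρ / 2 := by
      rw [hq', ENNReal.lt_ofReal_iff_toReal_lt (ENNReal.add_ne_top.2 ⟨by simp, hfin _ _⟩),
        ENNReal.toReal_add (by simp) (hfin _ _), ENNReal.toReal_ofReal hρ0.le] at hsum
      simp only [f] at hsum ⊢
      linarith
    -- the move costs at most `2 * ρ`, and `f` decreases by more than `ρ / 2`
    refine ⟨y', by linarith, hy'.trans ?_⟩
    rw [hq', ← ENNReal.ofReal_ofNat 2, ← ENNReal.ofReal_mul (by norm_num)]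
    exact ENNReal.ofReal_le_ofReal (by linarith)
  obtain ⟨z, hz, hxz⟩ := exists_eq_zero_of_forall_exists_descent hf
    (fun y ↦ ENNReal.toReal_nonneg) (by norm_num) hdescent x
  refine ⟨z, ((ENNReal.toReal_eq_zero_iff _).1 hz).resolve_right (hfin _ _), hxz.trans_eq ?_⟩
  rw [ENNReal.ofReal_mul (by norm_num), ENNReal.ofReal_toReal (hfin _ _)]
  simp

omit [FiniteDimensional ℝ E] in
/-- The point `z` is the endpoint of a horizontal lift, which is as long as the path it lifts. -/
theorem HasHorizontalLifts.exists_eq {p : M → B} (hp : IsRiemannianSubmersion I J p)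
    (hlift : HasHorizontalLifts I J p) (x : M) (q : B) {c : ℝ≥0∞} (hc : edist (p x) q < c) :
    ∃ z, p z = q ∧ edist x z < c := by
  obtain ⟨γ, h0, h1, hγ, hlen⟩ := exists_path_pathELength_lt (I := J) hc
  obtain ⟨Γ, hΓ, hΓ0, hpΓ, hhor⟩ := hlift γ hγ x h0.symm
  refine ⟨Γ 1, by rw [hpΓ 1 (by simp), h1], ?_⟩
  rw [← hΓ0]
  refine (edist_le_pathELength (I := I) hΓ zero_le_one).trans_lt (lt_of_eq_of_lt ?_ hlen)
  rw [← Manifold.pathELength_congr hpΓ]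
  change _ = Manifold.pathELength J (p ∘ Γ) 0 1
  simp only [Manifold.pathELength_eq_lintegral_mfderivWithin_Icc]
  refine MeasureTheory.setLIntegral_congr_fun measurableSet_Icc fun t ht ↦ ?_
  have hp' : MDifferentiableAt I J p (Γ t) := (hp.contMDiff _).mdifferentiableAt (by simp)
  have huniq : UniqueMDiffWithinAt 𝓘(ℝ, ℝ) (Icc (0 : ℝ) 1) t := by
    rw [uniqueMDiffWithinAt_iff_uniqueDiffWithinAt]
    exact uniqueDiffOn_Icc zero_lt_one t ht
  have hcomp : mfderivWithin 𝓘(ℝ, ℝ) J (p ∘ Γ) (Icc 0 1) t =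
      (mfderiv I J p (Γ t)) ∘L (mfderivWithin 𝓘(ℝ, ℝ) I Γ (Icc 0 1) t) :=
    mfderiv_comp_mfderivWithin t hp' (hΓ.mdifferentiableOn one_ne_zero t ht) huniq
  have h2 : mfderivWithin 𝓘(ℝ, ℝ) J (p ∘ Γ) (Icc 0 1) t 1 =
      (mfderiv I J p (Γ t)) (mfderivWithin 𝓘(ℝ, ℝ) I Γ (Icc 0 1) t 1) := congr($hcomp 1)
  have h3 := hp.norm_eq (Γ t) _ (hhor t ht)
  rw [← ofReal_norm, ← ofReal_norm]
  exact congrArg ENNReal.ofReal (h3.symm.trans congr(‖$h2‖).symm)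

end Global
end

/-! ### Rough isometries -/

/-- A surjective map which does not increase distances is a rough isometry if its fibres are
uniformly bounded and distances to them are controlled by distances in the target. -/
lemma IsRoughIsometry.of_edist_le_of_exists_edist_le {X Y : Type*} [PseudoEMetricSpace X]
    [PseudoEMetricSpace Y] {φ : X → Y} {K C : ℝ≥0} (hK : 1 ≤ K)
    (hφ : ∀ x y, edist (φ x) (φ y) ≤ edist x y) (hsurj : Function.Surjective φ)
    (hdiam : ∀ x y, φ x = φ y → edist x y ≤ C)
    (hlift : ∀ x q, ∃ z, φ z = q ∧ edist x z ≤ K * edist (φ x) q) : IsRoughIsometry φ := by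
  refine ⟨⟨K, C, hK, fun x y ↦ ⟨?_, (hφ x y).trans ?_⟩⟩, 1, one_pos, fun q ↦ ?_⟩
  · obtain ⟨z, hz, hxz⟩ := hlift x (φ y)
    have hxy : edist x y ≤ K * edist (φ x) (φ y) + C :=
      (edist_triangle x z y).trans (add_le_add hxz (hdiam z y hz))
    rw [tsub_le_iff_right, one_div]
    have hK0 : (K : ℝ≥0∞) ≠ 0 := by exact_mod_cast (one_pos.trans_le hK).ne'
    have hK1 : (K : ℝ≥0∞)⁻¹ ≤ 1 := ENNReal.inv_le_one.2 (by exact_mod_cast hK)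
    calc (K : ℝ≥0∞)⁻¹ * edist x y
        ≤ (K : ℝ≥0∞)⁻¹ * (K * edist (φ x) (φ y) + C) := by gcongr
      _ = edist (φ x) (φ y) + (K : ℝ≥0∞)⁻¹ * C := by
        rw [mul_add, ← mul_assoc, ENNReal.inv_mul_cancel hK0 ENNReal.coe_ne_top, one_mul]
      _ ≤ edist (φ x) (φ y) + C := by
        gcongr
        exact mul_le_of_le_one_left zero_le hK1
  · calc edist x y = 1 * edist x y := (one_mul _).symm
      _ ≤ K * edist x y := by
        gcongr
        exact_mod_cast hK
      _ ≤ _ := le_self_add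
  · obtain ⟨x, rfl⟩ := hsurj q
    rw [Metric.infEDist_zero_of_mem (mem_range_self x)]
    exact one_pos

lemma IsRoughIsometry.prodMk_const {X Y Z : Type*} [PseudoEMetricSpace X] [PseudoEMetricSpace Y]
    [PseudoEMetricSpace Z] {φ : X → Y} (hφ : IsRoughIsometry φ) (z₀ : Z) {m : ℝ≥0}
    (hm : ∀ z, edist z z₀ ≤ m) :
    IsRoughIsometry (fun x ↦ WithLp.toLp 2 (z₀, φ x)) := by
  have htwo : 0 < (2 : ℝ≥0∞).toReal := by simp
  have hsnd (z : Z) (y y' : Y) :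
      edist (WithLp.toLp 2 (z, y)) (WithLp.toLp 2 (z, y')) = edist y y' := by
    simp [WithLp.prod_edist_eq_add htwo, ← ENNReal.rpow_natCast_mul]
  have hfst (z z' : Z) (y : Y) :
      edist (WithLp.toLp 2 (z, y)) (WithLp.toLp 2 (z', y)) = edist z z' := by
    simp [WithLp.prod_edist_eq_add htwo, ← ENNReal.rpow_natCast_mul]
  obtain ⟨A, C, hA, hAC⟩ := hφ.exists_distortion
  obtain ⟨ε, hε, hfull⟩ := hφ.full
  refine ⟨⟨A, C, hA, fun x x' ↦ by simpa only [hsnd] using hAC x x'⟩, m + ε, by positivity, ?_⟩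
  rintro ⟨z, y⟩
  obtain ⟨_, ⟨x, rfl⟩, hx⟩ := Metric.infEDist_lt_iff.1 (hfull y)
  refine Metric.infEDist_lt_iff.2 ⟨_, ⟨x, rfl⟩, ?_⟩
  refine (edist_triangle _ (WithLp.toLp 2 (z₀, y)) _).trans_lt ?_
  rw [hfst, hsnd, ENNReal.coe_add]
  exact ENNReal.add_lt_add_of_le_of_lt ((hm z).trans_lt ENNReal.coe_lt_top).ne (hm z) hx

end

theorem theorem4p1p3 {k n : ℕ}
    {M : Type*} [EMetricSpace M] [ChartedSpace (EuclideanSpace ℝ (Fin k)) M]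
    [IsManifold (𝓡 k) ∞ M]
    [RiemannianBundle (fun x : M ↦ TangentSpace (𝓡 k) x)]
    [IsContMDiffRiemannianBundle (𝓡 k) ∞ (EuclideanSpace ℝ (Fin k))
      (fun x : M ↦ TangentSpace (𝓡 k) x)]
    [IsRiemannianManifold (𝓡 k) M]
    {B : Type*} [EMetricSpace B] [ChartedSpace (EuclideanSpace ℝ (Fin n)) B]
    [IsManifold (𝓡 n) ∞ B]
    [RiemannianBundle (fun b : B ↦ TangentSpace (𝓡 n) b)]
    [IsContMDiffRiemannianBundle (𝓡 n) ∞ (EuclideanSpace ℝ (Fin n))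
      (fun b : B ↦ TangentSpace (𝓡 n) b)]
    [IsRiemannianManifold (𝓡 n) B]
    [ConnectedSpace B] [CompleteSpace B]
    (p : M → B) (hp : IsRiemannianSubmersion (𝓡 k) (𝓡 n) p)
    (hlift : CompleteSpace M ∨ HasHorizontalLifts (𝓡 k) (𝓡 n) p)
    (m : ℝ) (hm : 0 < m)
    (hdiam : ∀ b : B, Metric.ediam (p ⁻¹' {b}) ≤ ENNReal.ofReal m) :
    IsRoughIsometry p ∧
      ∀ b₀ : B, IsCompact (p ⁻¹' {b₀}) →
        RoughlyIsometric M (WithLp 2 ((p ⁻¹' {b₀} : Set M) × B)) := by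
  have hD (x y : M) (hxy : p x = p y) : edist x y ≤ (m.toNNReal : ℝ≥0∞) :=
    (Metric.edist_le_ediam_of_mem (s := p ⁻¹' {p y}) hxy rfl).trans (hdiam _)
  have hrough : IsRoughIsometry p := by
    refine IsRoughIsometry.of_edist_le_of_exists_edist_le (K := 4) (by norm_num) hp.edist_le
      hp.surjective hD fun x q ↦ ?_
    rcases hlift with hM | hlift
    · have := isContinuousRiemannianBundle_tangentSpace (𝓡 k) (M := M)
      have := isContinuousRiemannianBundle_tangentSpace (𝓡 n) (M := B)
      obtain ⟨z, hz, hxz⟩ := hp.exists_eq_of_completeSpace x q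
      exact ⟨z, edist_eq_zero.1 hz, hxz⟩
    · rcases eq_or_ne (p x) q with rfl | hne
      · exact ⟨x, rfl, by simp⟩
      · have hlt : edist (p x) q < 4 * edist (p x) q := by
          have h1 := ENNReal.mul_lt_mul_left (edist_pos.2 hne).ne'
            (edist_ne_top_of_connectedSpace (p x) q) (show (1 : ℝ≥0∞) < 4 by norm_num)
          rwa [one_mul] at h1
        obtain ⟨z, hz, hxz⟩ := hlift.exists_eq hp x q hlt
        exact ⟨z, hz, hxz.le⟩
  refine ⟨hrough, fun b₀ _ ↦ ?_⟩
  obtain ⟨x₀, hx₀⟩ := hp.surjective b₀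
  exact ⟨_, hrough.prodMk_const (⟨x₀, hx₀⟩ : (p ⁻¹' {b₀} : Set M))
    fun z ↦ hD z x₀ (z.2.trans hx₀.symm)⟩
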